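/- Let $X$ be a paracompact Tychonoff space, regarded as a subspace of its Stone–Čech compactification $\beta X$. Then $X$ is Čech-complete (that is, $X$ is a $G_\delta$ subset of $\beta X$) if and only if player 2 has a winning strategy in the Menger game $\mathsf{G}_{\mathrm{fin}}(\mathcal{O},\mathcal{O})$ played on the subspace $Y=\beta X\setminus X$. Here $\mathcal{O}$ is the collection of all open covers of $Y$. In each inning $n=0,1,2,\dots$ of the game, player 1 chooses an open cover $\mathcal{U}_n$ of $Y$ and then player 2 chooses a finite subset $\mathcal{V}_n\subseteq\mathcal{U}_n$; player 2 wins the play if $\bigcup_{n}\mathcal{V}_n$ covers $Y$, and player 1 wins otherwise. A strategy for player 2 determines $\mathcal{V}_n$ from the moves $\mathcal{U}_0,\dots,\mathcal{U}_n$ of player 1. -/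

import Mathlib

/-- The collection `𝒪` of all open covers of the space `Y`. -/
def openCovers (Y : Type*) [TopologicalSpace Y] : Set (Set (Set Y)) :=
  {U | (∀ u ∈ U, IsOpen u) ∧ ⋃₀ U = Set.univ}

/-- A strategy of player 2 in the selection game `G_fin(𝒜, ℬ)`, in which at each inning
`n = 0, 1, 2, …` player 1 chooses `A n ∈ 𝒜` and player 2 answers with a finite `F n ⊆ A n`.
The answer `answer h A` depends on the list `h` of the earlier moves of player 1
(in the order in which they were played) and on the current move `A` of player 1. -/
structure GFinStrategyTwo {α : Type*} (𝒜 : Set (Set α)) where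
  answer : List 𝒜 → 𝒜 → Set α
  finite_answer : ∀ (h : List 𝒜) (A : 𝒜), (answer h A).Finite
  answer_subset : ∀ (h : List 𝒜) (A : 𝒜), answer h A ⊆ (A : Set α)

/-- The set of everything that player 2 selects during the infinite play in which player 1
plays `A 0, A 1, A 2, …` and player 2 follows the strategy `σ`. -/
def GFinStrategyTwo.selected {α : Type*} {𝒜 : Set (Set α)} (σ : GFinStrategyTwo 𝒜)
    (A : ℕ → 𝒜) : Set α :=
  ⋃ n : ℕ, σ.answer (List.ofFn fun i : Fin n => A i) (A n)

/-- Player 2 has a winning strategy in `G_fin(𝒜, ℬ)`: following it, the union of the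
selected finite sets belongs to `ℬ`, whatever player 1 plays. -/
def PlayerTwoWinsGFin {α : Type*} (𝒜 ℬ : Set (Set α)) : Prop :=
  ∃ σ : GFinStrategyTwo 𝒜, ∀ A : ℕ → 𝒜, σ.selected A ∈ ℬ

/-- Player 2 has a winning strategy in the Menger game `G_fin(𝒪, 𝒪)` played on `Y`. -/
def PlayerTwoWinsMenger (Y : Type*) [TopologicalSpace Y] : Prop :=
  PlayerTwoWinsGFin (openCovers Y) (openCovers Y)

/-- The remainder `βX ∖ X` (with the subspace topology), where a Tychonoff space `X` is
identified with its canonical image in `βX`. -/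
abbrev StoneCechRemainder (X : Type*) [TopologicalSpace X] : Type _ :=
  {p : StoneCech X // p ∉ Set.range (stoneCechUnit : X → StoneCech X)}

/-- `X` is Čech-complete: it is Tychonoff and a `G_δ` subset of `βX`. -/
def IsCechComplete (X : Type*) [TopologicalSpace X] : Prop :=
  T35Space X ∧ IsGδ (Set.range (stoneCechUnit : X → StoneCech X))

open Set Topology

section SigmaCompact

/-! If `X` is `G_δ`, its remainder is σ-compact. Conversely, fix a winning strategy. After any
history, each point of `X` lies off the closure of the answer to some cover, so the complements of
these closures cover `X`; paracompactness refines them to open sets locally finite at `X`. This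
gives a tree of covers indexed by histories. A point in all the sets along a branch is missed by
that play, hence lies in `X`. Local finiteness and König's lemma produce a branch from membership at
every level, so countably many open conditions define `X`. -/

/-- On a σ-compact space player 2 wins the Menger game: at inning `n`, cover the `n`-th compact
set by finitely many members of the current cover. -/
theorem playerTwoWinsMenger_of_iUnion_isCompact {Y : Type*} [TopologicalSpace Y] (K : ℕ → Set Y)
    (hK : ∀ n, IsCompact (K n)) (hKY : ⋃ n, K n = univ) : PlayerTwoWinsMenger Y := by
  have fin_cover : ∀ (n : ℕ) (A : openCovers Y),
      ∃ F ⊆ (A : Set (Set Y)), F.Finite ∧ K n ⊆ ⋃₀ F := fun n A => by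
    obtain ⟨F, hFA, hF, hKF⟩ := (hK n).elim_finite_subcover_image (b := (A : Set (Set Y))) (c := id)
      A.2.1 (by simp [← sUnion_eq_biUnion, A.2.2])
    exact ⟨F, hFA, hF, by simpa [sUnion_eq_biUnion] using hKF⟩
  choose F hFA hF hKF using fin_cover
  refine ⟨⟨fun h A => F h.length A, fun h A => hF _ A, fun h A => hFA _ A⟩, fun A => ⟨?_, ?_⟩⟩
  · intro u hu
    obtain ⟨n, hn⟩ := mem_iUnion.1 hu
    exact (A n).2.1 u (hFA _ _ hn)
  · refine eq_univ_of_forall fun y => ?_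
    obtain ⟨n, hn⟩ := mem_iUnion.1 (hKY ▸ mem_univ y : y ∈ ⋃ n, K n)
    obtain ⟨u, hu, hyu⟩ := hKF n (A n) hn
    exact ⟨u, mem_iUnion.2 ⟨n, by simpa using hu⟩, hyu⟩

theorem playerTwoWinsMenger_compl_of_isGδ {Z : Type*} [TopologicalSpace Z] [CompactSpace Z]
    {S : Set Z} (hS : IsGδ S) : PlayerTwoWinsMenger {p : Z // p ∉ S} := by
  obtain ⟨f, hf, rfl⟩ := isGδ_iff_eq_iInter_nat.1 hS
  refine playerTwoWinsMenger_of_iUnion_isCompact (fun n => Subtype.val ⁻¹' (f n)ᶜ)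
    (fun n => ?_) ?_
  · rw [Subtype.isCompact_iff, image_preimage_eq_of_subset]
    · exact (hf n).isClosed_compl.isCompact
    · exact fun p hp => ⟨⟨p, fun hpf => hp (mem_iInter.1 hpf n)⟩, rfl⟩
  · refine eq_univ_of_forall fun y => ?_
    simpa using y.2

end SigmaCompact

section TreeOfCovers

/-- The trace in `Z` of the refined covers `v` along a history, most recent move first. -/
def historySet {Z C : Type*} (v : List C → C → Set Z) : List C → Set Z
  | [] => univ
  | c :: r => historySet v r ∩ v r c

theorem isOpen_historySet {Z C : Type*} [TopologicalSpace Z] {v : List C → C → Set Z}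
    (hv : ∀ r c, IsOpen (v r c)) : ∀ r, IsOpen (historySet v r)
  | [] => isOpen_univ
  | c :: r => (isOpen_historySet hv r).inter (hv r c)

theorem historySet_append_subset {Z C : Type*} (v : List C → C → Set Z) (r : List C) :
    ∀ q, historySet v (q ++ r) ⊆ historySet v r
  | [] => subset_rfl
  | _ :: q => inter_subset_left.trans (historySet_append_subset v r q)

theorem exists_mem_historySet {Z C : Type*} {v : List C → C → Set Z} {x : Z}
    (hx : ∀ r, ∃ c, x ∈ v r c) : ∀ n : ℕ, ∃ r : List C, r.length = n ∧ x ∈ historySet v r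
  | 0 => ⟨[], rfl, mem_univ x⟩
  | n + 1 => by
    obtain ⟨r, hr, hxr⟩ := exists_mem_historySet hx n
    obtain ⟨c, hc⟩ := hx r
    exact ⟨c :: r, by simp [hr], hxr, hc⟩

/-- If every cover of the tree is locally finite at `x`, so is each level of the tree. -/
theorem exists_nhds_finite_historySet {Z C : Type*} [TopologicalSpace Z]
    {v : List C → C → Set Z} {x : Z}
    (hx : ∀ r, ∃ N ∈ 𝓝 x, {c | (v r c ∩ N).Nonempty}.Finite) :
    ∀ n : ℕ, ∃ N ∈ 𝓝 x, {r : List C | r.length = n ∧ (historySet v r ∩ N).Nonempty}.Finite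
  | 0 => ⟨univ, Filter.univ_mem, (finite_singleton []).subset fun r hr => by simpa using hr.1⟩
  | n + 1 => by
    obtain ⟨N, hN, hfin⟩ := exists_nhds_finite_historySet hx n
    choose M hM hMfin using hx
    -- Only the finitely many parents meeting `N` can have children meeting it.
    refine ⟨N ∩ ⋂ r ∈ {r : List C | r.length = n ∧ (historySet v r ∩ N).Nonempty}, M r,
      Filter.inter_mem hN ((Filter.biInter_mem hfin).2 fun r _ => hM r), ?_⟩
    refine (hfin.biUnion fun r _ => (hMfin r).image (· :: r)).subset ?_
    rintro (_ | ⟨c, r⟩) ⟨hlen, z, hz, hzN, hzM⟩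
    · simp at hlen
    · have hr : r.length = n ∧ (historySet v r ∩ N).Nonempty :=
        ⟨by simpa using hlen, z, hz.1, hzN⟩
      exact mem_biUnion hr ⟨c, ⟨z, hz.2, mem_iInter₂.1 hzM r hr⟩, rfl⟩

/-- König's lemma for the tree of histories whose trace contains `p`. -/
theorem exists_branch_of_finite_historySet {Z C : Type*} {v : List C → C → Set Z} {p : Z}
    (hne : ∀ n : ℕ, ∃ r : List C, r.length = n ∧ p ∈ historySet v r)
    (hfin : ∀ n : ℕ, {r : List C | r.length = n ∧ p ∈ historySet v r}.Finite) :
    ∃ A : ℕ → C, ∀ n, p ∈ v (List.ofFn fun i : Fin n => A i).reverse (A n) := by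
  let Good : List C → Prop := fun r => ∀ k, ∃ q : List C, q.length = k ∧ p ∈ historySet v (q ++ r)
  have good_nil : Good [] := fun k => by simpa using hne k
  have mem_of_good : ∀ {r}, Good r → p ∈ historySet v r := fun {r} hr => by
    obtain ⟨q, -, hq⟩ := hr 0
    exact historySet_append_subset v r q hq
  have good_cons : ∀ r, Good r → ∃ c, Good (c :: r) := by
    intro r hr
    by_contra! hbad
    have hbad' : ∀ c, ∃ k, ∀ q : List C, q.length = k → p ∉ historySet v (q ++ c :: r) := by
      simpa [Good] using hbad
    choose k hk using hbad'
    have hC : {c | p ∈ historySet v (c :: r)}.Finite :=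
      ((hfin (r.length + 1)).preimage (f := (· :: r))
        (fun _ _ _ _ h => (List.cons.inj h).1)).subset fun c hc => ⟨by simp, hc⟩
    -- `m` bounds the heights of the dead subtrees above `r`; a longer extension contradicts this.
    obtain ⟨m, hm⟩ := (hC.image k).bddAbove
    obtain ⟨q, hq, hpq⟩ := hr (m + 1)
    -- The most recent move comes first, so the last entry of `q` is the move made right after `r`.
    obtain ⟨q', c, rfl⟩ : ∃ q' c, q = q' ++ [c] :=
      ⟨q.dropLast, q.getLast (by rintro rfl; simp at hq), (List.dropLast_append_getLast _).symm⟩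
    rw [List.append_assoc, List.singleton_append] at hpq
    have hlen : q'.length = m := by simpa using hq
    have hkm : k c ≤ m := hm ⟨c, historySet_append_subset v _ _ hpq, rfl⟩
    refine hk c (q'.drop (m - k c)) (by simp [hlen]; omega) ?_
    rw [← List.take_append_drop (m - k c) q', List.append_assoc] at hpq
    exact historySet_append_subset v _ _ hpq
  have : Nonempty C := (good_cons [] good_nil).nonempty
  choose! next hnext using good_cons
  let R : ℕ → List C := fun n => Nat.rec [] (fun _ r => next r :: r) n
  have hR : ∀ n, Good (R n) := fun n => by
    induction n with
    | zero => exact good_nil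
    | succ n ih => exact hnext _ ih
  have hRA : ∀ n, R n = (List.ofFn fun i : Fin n => next (R i)).reverse := fun n => by
    induction n with
    | zero => rfl
    | succ n ih =>
      rw [List.ofFn_succ', List.concat_eq_append, List.reverse_append]
      change next (R n) :: R n = _
      conv_lhs => rw [ih]
      simp [← ih]
  refine ⟨fun n => next (R n), fun n => ?_⟩
  rw [← hRA n]
  exact (mem_of_good (hR (n + 1))).2

/-- A dense subset `S` is `G_δ` if it carries a tree of locally finite open covers
all of whose branches have intersection inside `S`. -/
theorem isGδ_of_tree_of_covers {Z C : Type*} [TopologicalSpace Z] {S : Set Z}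
    {v : List C → C → Set Z} (hv : ∀ r c, IsOpen (v r c))
    (hcov : ∀ x ∈ S, ∀ r, ∃ c, x ∈ v r c)
    (hlf : ∀ x ∈ S, ∀ r, ∃ N ∈ 𝓝 x, {c | (v r c ∩ N).Nonempty}.Finite)
    (hbr : ∀ p, ∀ A : ℕ → C,
      (∀ n, p ∈ v (List.ofFn fun i : Fin n => A i).reverse (A n)) → p ∈ S) :
    IsGδ S := by
  let L : ℕ → Set (List C) := fun n => {r | r.length = n}
  -- The second factor keeps level `n` finite at every point of `G n`, as König's lemma needs even
  -- outside `S`.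
  let G : ℕ → Set Z := fun n => (⋃ r ∈ L n, historySet v r) ∩
    ⋃₀ {N | IsOpen N ∧ {r : List C | r.length = n ∧ (historySet v r ∩ N).Nonempty}.Finite}
  have hS : S = ⋂ n, G n := by
    refine Subset.antisymm (fun x hx => mem_iInter.2 fun n => ⟨?_, ?_⟩) fun p hp => ?_
    · obtain ⟨r, hr, hxr⟩ := exists_mem_historySet (hcov x hx) n
      exact mem_biUnion (show r ∈ L n from hr) hxr
    · obtain ⟨N, hN, hfin⟩ := exists_nhds_finite_historySet (hlf x hx) n
      exact ⟨interior N, ⟨isOpen_interior, hfin.subset fun r hr =>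
        ⟨hr.1, hr.2.mono (inter_subset_inter_right _ interior_subset)⟩⟩,
        mem_interior_iff_mem_nhds.2 hN⟩
    · rw [mem_iInter] at hp
      obtain ⟨A, hA⟩ := exists_branch_of_finite_historySet (v := v) (p := p)
        (fun n => by
          obtain ⟨r, hr, hpr⟩ := mem_iUnion₂.1 (hp n).1
          exact ⟨r, hr, hpr⟩)
        (fun n => by
          obtain ⟨N, ⟨-, hfin⟩, hpN⟩ := (hp n).2
          exact hfin.subset fun r hr => ⟨hr.1, p, hr.2, hpN⟩)
      exact hbr p A hA
  rw [hS]
  refine IsGδ.iInter_of_isOpen fun n => ?_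
  exact (isOpen_biUnion fun r _ => isOpen_historySet hv r).inter (isOpen_sUnion fun N hN => hN.1)

end TreeOfCovers

/-- Open sets of `Z` covering a densely embedded paracompact space `X` have an open refinement in
`Z` that still covers `X` and is locally finite at the points of `X`. -/
theorem IsDenseInducing.exists_locallyFinite_refinement {X Z C : Type*} [TopologicalSpace X]
    [TopologicalSpace Z] [ParacompactSpace X] {e : X → Z} (he : IsDenseInducing e)
    (W : C → Set Z) (hW : ∀ c, IsOpen (W c)) (hcov : ∀ x, ∃ c, e x ∈ W c) :
    ∃ v : C → Set Z, (∀ c, IsOpen (v c)) ∧ (∀ c, v c ⊆ W c) ∧ (∀ x, ∃ c, e x ∈ v c) ∧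
      ∀ x, ∃ N ∈ 𝓝 (e x), {c | (v c ∩ N).Nonempty}.Finite := by
  obtain ⟨u, huo, huc, hulf, huW⟩ := precise_refinement (fun c => e ⁻¹' W c)
    (fun c => (hW c).preimage he.continuous)
    (eq_univ_of_forall fun x => mem_iUnion.2 (hcov x))
  choose O hO hOu using fun c => he.isInducing.isOpen_iff.1 (huo c)
  refine ⟨fun c => O c ∩ W c, fun c => (hO c).inter (hW c), fun c => inter_subset_right,
    fun x => ?_, fun x => ?_⟩
  · obtain ⟨c, hc⟩ := mem_iUnion.1 (huc ▸ mem_univ x : x ∈ ⋃ c, u c)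
    exact ⟨c, (hOu c).ge hc, huW c hc⟩
  · obtain ⟨t, ht, hfin⟩ := hulf x
    rw [he.isInducing.nhds_eq_comap] at ht
    obtain ⟨N, hN, hNt⟩ := ht
    refine ⟨interior N, interior_mem_nhds.2 hN, hfin.subset ?_⟩
    rintro c hc
    -- By density a nonempty open intersection in `Z` is witnessed in `X`, so finiteness transfers
    -- to `Z`.
    obtain ⟨x', hx'⟩ := he.dense.exists_mem_open
      (((hO c).inter (hW c)).inter isOpen_interior) hc
    exact ⟨x', (hOu c).le hx'.1.1, hNt (interior_subset (s := N) hx'.2)⟩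

/-- Player 2 has to leave every given point of `Z` outside `Y` away from the closure of the answer
to some cover. -/
theorem GFinStrategyTwo.exists_notMem_closure_answer {Z : Type*} [TopologicalSpace Z] [T2Space Z]
    {S : Set Z} (σ : GFinStrategyTwo (openCovers {p : Z // p ∉ S}))
    (h : List (openCovers {p : Z // p ∉ S})) {x : Z} (hx : x ∈ S) :
    ∃ A, x ∉ closure (Subtype.val '' ⋃₀ σ.answer h A) := by
  let A : openCovers {p : Z // p ∉ S} :=
    ⟨{u | IsOpen u ∧ x ∉ closure (Subtype.val '' u)}, fun u hu => hu.1, by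
      refine eq_univ_of_forall fun y => ?_
      obtain ⟨a, b, ha, hb, hya, hxb, hab⟩ := t2_separation (x := (y : Z)) (y := x)
        (fun hyx => y.2 (hyx ▸ hx))
      refine ⟨Subtype.val ⁻¹' a, ⟨ha.preimage continuous_subtype_val, fun hxa => ?_⟩, hya⟩
      exact (hab.closure_left hb).le_bot
        ⟨closure_mono (image_preimage_subset _ _) hxa, hxb⟩⟩
  refine ⟨A, ?_⟩
  -- The answer is finite, so its closure is the union of the closures of its members.
  rw [image_sUnion, sUnion_image, (σ.finite_answer h A).closure_biUnion]
  simp only [mem_iUnion, not_exists]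
  exact fun u hu => (σ.answer_subset h A hu).2

theorem isGδ_range_of_playerTwoWinsMenger {X Z : Type*} [TopologicalSpace X] [ParacompactSpace X]
    [TopologicalSpace Z] [T2Space Z] {e : X → Z} (he : IsDenseInducing e)
    (hwin : PlayerTwoWinsMenger {p : Z // p ∉ range e}) : IsGδ (range e) := by
  obtain ⟨σ, hσ⟩ := hwin
  let C := openCovers {p : Z // p ∉ range e}
  let W : List C → C → Set Z := fun r A =>
    (closure (Subtype.val '' ⋃₀ σ.answer r.reverse A))ᶜ
  choose v hvo hvW hvc hvlf using fun r => he.exists_locallyFinite_refinement (W r)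
    (fun _ => isClosed_closure.isOpen_compl)
    (fun x => σ.exists_notMem_closure_answer r.reverse (mem_range_self x))
  refine isGδ_of_tree_of_covers hvo (by rintro _ ⟨x, rfl⟩ r; exact hvc r x)
    (by rintro _ ⟨x, rfl⟩ r; exact hvlf r x) fun p A hA => ?_
  by_contra hp
  obtain ⟨u, hu, hpu⟩ := (hσ A).2.symm ▸ mem_univ (⟨p, hp⟩ : {p : Z // p ∉ range e})
  obtain ⟨n, hn⟩ := mem_iUnion.1 hu
  refine hvW _ _ (hA n) (subset_closure ⟨⟨p, hp⟩, ⟨u, ?_, hpu⟩, rfl⟩)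
  rwa [List.reverse_reverse]

theorem corollary3p3 (X : Type*) [TopologicalSpace X] [T35Space X] [ParacompactSpace X] :
    IsCechComplete X ↔ PlayerTwoWinsMenger (StoneCechRemainder X) :=
  ⟨fun h => playerTwoWinsMenger_compl_of_isGδ h.2, fun h =>
    ⟨inferInstance, isGδ_range_of_playerTwoWinsMenger isDenseInducing_stoneCechUnit h⟩⟩
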